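/- Let $p$ be a prime and $n>0$ an integer. For integers $m,k\ge 0$ let $$\binom{m}{k}_p=\prod_{t=0}^{k-1}\frac{p^{m-t}-1}{p^{t+1}-1}$$ be the Gaussian binomial coefficient for $k\le m$ (and $0$ for $k>m$), and for $d\ge 0$ put $a_d=\sum_{i=0}^{d}\binom{d}{i}_p$. For a group $G$, a transfer system on the subgroup lattice $\mathsf{Sub}(G)$ is a partial order $\to$ on $\mathsf{Sub}(G)$ such that $H\to K$ implies $H\le K$; $H\to K$ implies $gHg^{-1}\to gKg^{-1}$ for all $g\in G$; and $H\to K$ together with $H'\le K$ implies $H\cap H'\to H'$. Transfer systems on $\mathsf{Sub}(G)$, ordered by inclusion of relations, form a complete lattice $\mathsf{Tr}(\mathsf{Sub}(G))$, which is finite if $G$ is finite. For a finite lattice $L$ let $J(L)$ (respectively $M(L)$) be the set of those $x\in L$ such that, for every $X\subseteq L$, $x=\bigvee X$ (respectively $x=\bigwedge X$) implies $x\in X$. The codensity of the reduced formal context $(J(L),M(L),\le)$ is $$\rho(L)=\frac{|\{(A,B)\in J(L)\times M(L): A\not\le B\}|}{|J(L)|\,|M(L)|}.$$ Then, for the elementary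 abelian group $C_p^n$, $$\rho(\mathsf{Tr}(\mathsf{Sub}(C_p^n)))=\frac{\displaystyle\sum_{i=0}^{n-1}\sum_{j=1}^{n-i}\sum_{k=0}^{n-i-j}\binom{n}{i}_p\binom{n-i}{j}_p\binom{n-i-j}{k}_p\,(a_{j+k}-a_k)}{\displaystyle\Bigl(\sum_{i=0}^{n-1}\binom{n}{i}_p\,(a_{n-i}-1)\Bigr)^2}.$$ -/

import Mathlib

open scoped Pointwise

noncomputable section

namespace HomotopicalCombinatorics

/-! ### Transfer systems on a lattice with group action -/

/-- A transfer system on a `G`-lattice `L`, i.e. a lattice on which the group `G` acts by lattice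
automorphisms (a group action by monotone maps): a partial order `rel` on `L` refining `≤`,
respecting the action of `G`, and closed under restriction.
Antisymmetry of `rel` follows from `le_of_rel`, see `TransferSystem.rel_antisymm`. -/
@[ext]
structure TransferSystem (G L : Type*) [Group G] [Lattice L] [MulAction G L]
    [CovariantClass G L (· • ·) (· ≤ ·)] where
  rel : L → L → Prop
  rel_refl : ∀ x, rel x x
  rel_trans : ∀ {x y z}, rel x y → rel y z → rel x z
  le_of_rel : ∀ {x y}, rel x y → x ≤ y
  smul_rel : ∀ (g : G) {x y}, rel x y → rel (g • x) (g • y)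
  inf_rel : ∀ {x y x'}, rel x y → x' ≤ y → rel (x ⊓ x') x'

namespace TransferSystem

variable {G L : Type*} [Group G] [Lattice L] [MulAction G L]
  [CovariantClass G L (· • ·) (· ≤ ·)]

theorem rel_antisymm (T : TransferSystem G L) {x y : L} (h : T.rel x y) (h' : T.rel y x) :
    x = y :=
  le_antisymm (T.le_of_rel h) (T.le_of_rel h')

/-- Transfer systems are ordered by refinement, i.e. by inclusion of relations. -/
instance : PartialOrder (TransferSystem G L) where
  le S T := ∀ ⦃x y⦄, S.rel x y → T.rel x y
  le_refl _ _ _ h := h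
  le_trans _ _ _ h h' _ _ hxy := h' (h hxy)
  le_antisymm S T h h' := by
    ext x y
    exact ⟨fun k => h k, fun k => h' k⟩

/-- The meet of a family of transfer systems is the intersection (which for the empty family
is the largest transfer system `≤`). -/
instance : InfSet (TransferSystem G L) where
  sInf 𝒯 :=
    { rel := fun x y => x ≤ y ∧ ∀ T ∈ 𝒯, T.rel x y
      rel_refl := fun x => ⟨le_rfl, fun T _ => T.rel_refl x⟩
      rel_trans := fun h h' =>
        ⟨h.1.trans h'.1, fun T hT => T.rel_trans (h.2 T hT) (h'.2 T hT)⟩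
      le_of_rel := fun h => h.1
      smul_rel := fun g _ _ h =>
        ⟨CovariantClass.elim g h.1, fun T hT => T.smul_rel g (h.2 T hT)⟩
      inf_rel := fun h hx => ⟨inf_le_right, fun T hT => T.inf_rel (h.2 T hT) hx⟩ }

theorem isGLB_sInf (𝒯 : Set (TransferSystem G L)) : IsGLB 𝒯 (sInf 𝒯) :=
  ⟨fun T hT _ _ h => h.2 T hT,
    fun S hS _ _ h => ⟨S.le_of_rel h, fun _ hT => hS hT h⟩⟩

/-- The lattice `Tr(L)` of transfer systems. -/
instance : CompleteLattice (TransferSystem G L) :=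
  completeLatticeOfInf _ isGLB_sInf

instance [Finite L] : Finite (TransferSystem G L) :=
  Finite.of_injective (fun T : TransferSystem G L => T.rel) fun _ _ h => TransferSystem.ext h

end TransferSystem

/-- `Tr(Sub(G))`: transfer systems on the subgroup lattice of `G` with the conjugation action.
Here `ConjAct G` is the group `G`, acting on subgroups by `g • H = g H g⁻¹`. -/
abbrev TrSub (G : Type*) [Group G] : Type _ := TransferSystem (ConjAct G) (Subgroup G)

/-! ### Irreducibles and codensity -/

/-- The set `J(L)` of join-irreducible elements. -/
def joinIrreducibles (L : Type*) [CompleteLattice L] : Set L :=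
  {x | ∀ X : Set L, x = sSup X → x ∈ X}

/-- The set `M(L)` of meet-irreducible elements. -/
def meetIrreducibles (L : Type*) [CompleteLattice L] : Set L :=
  {x | ∀ X : Set L, x = sInf X → x ∈ X}

/-- The codensity `ρ(L)` of a finite lattice `L`: the proportion of pairs in `J(L) × M(L)` that do
not lie in the relation `≤` of the reduced formal context `(J(L), M(L), ≤)`. -/
def codensity (L : Type*) [CompleteLattice L] [Finite L] : ℚ :=
  (Set.ncard {q : L × L | q.1 ∈ joinIrreducibles L ∧ q.2 ∈ meetIrreducibles L ∧ ¬ q.1 ≤ q.2} : ℚ) /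
    ((joinIrreducibles L).ncard * (meetIrreducibles L).ncard)

/-! ### Gaussian binomials -/

/-- The Gaussian binomial coefficient
`[n choose k]_q = ∏_{t=0}^{k-1} (q^(n-t) - 1) / (q^(t+1) - 1)`, for an integer `q ≥ 2`.
For `k > n` the factor with `t = n` vanishes, so the value is `0`. -/
def gaussBinom (q n k : ℕ) : ℚ :=
  ∏ t ∈ Finset.range k, ((q : ℚ) ^ (n - t) - 1) / ((q : ℚ) ^ (t + 1) - 1)

/-- `a_d = ∑_{i=0}^{d} [d choose i]_q`. -/
def gaussSum (q d : ℕ) : ℚ :=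
  ∑ i ∈ Finset.range (d + 1), gaussBinom q d i

/-- The elementary abelian group `C_p^n`, written multiplicatively. -/
abbrev ElemAb (p n : ℕ) : Type := Fin n → Multiplicative (ZMod p)

end HomotopicalCombinatorics

end

/-! Since `C_p^n` is abelian, conjugation fixes every subgroup, and the problem concerns transfer
systems on a finite lattice with trivial action. There the join-irreducibles are the systems
`principal x y` with `x < y` (`joinIrreducibles_eq`), and the meet-irreducibles are the systems
`lifting a b` with `a < b` (`meetIrreducibles_eq`). Moreover `principal x y ≤ lifting a b` fails
exactly when `a ≤ x`, `b ≤ y` and `¬ b ≤ x`. So the codensity counts such quadruples and divides by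
the square of the number of strict pairs (`codensity_eq`).

Subgroups of `C_p^n` are subspaces of `F_p^n`. Let `a` have dimension `i`, `b` dimension `j` over
`a`, and `y` dimension `k` over `b`. Gaussian binomials count these choices, and `x` ranges over
`[a, y]` minus `[b, y]`, which has `a_{j+k} - a_k` elements (`ncard_not_lifting_submodule`). -/

open scoped Pointwise

namespace HomotopicalCombinatorics

/-! ### Irreducible transfer systems and codensity for a trivial action. -/

namespace TransferSystem

variable {G L : Type*} [Group G] [Lattice L] [MulAction G L]
  [CovariantClass G L (· • ·) (· ≤ ·)]

/-- The transfer system generated by `x → y` (for `x ≤ y`), when `G` acts trivially. -/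
def principal (triv : ∀ (g : G) (z : L), g • z = z) (x y : L) : TransferSystem G L where
  rel u v := u = v ∨ (v ≤ y ∧ u = x ⊓ v)
  rel_refl _ := Or.inl rfl
  rel_trans := by
    rintro u v w (rfl | ⟨hv, rfl⟩) (rfl | ⟨hw, rfl⟩)
    · exact Or.inl rfl
    · exact Or.inr ⟨hw, rfl⟩
    · exact Or.inr ⟨hv, rfl⟩
    · exact Or.inr ⟨hw, by simp⟩
  le_of_rel := by
    rintro u v (rfl | ⟨-, rfl⟩)
    exacts [le_rfl, inf_le_right]
  smul_rel g u v h := by rwa [triv, triv]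
  inf_rel := by
    rintro u v w (rfl | ⟨hv, rfl⟩) hw
    · exact Or.inl (inf_eq_right.2 hw)
    · exact Or.inr ⟨hw.trans hv, by rw [inf_assoc, inf_eq_right.2 hw]⟩

/-- The part of `principal x y` consisting of the proper restrictions of `x → y`. -/
def principalLower (triv : ∀ (g : G) (z : L), g • z = z) (x y : L) : TransferSystem G L where
  rel u v := u = v ∨ (v < y ∧ u = x ⊓ v)
  rel_refl _ := Or.inl rfl
  rel_trans := by
    rintro u v w (rfl | ⟨hv, rfl⟩) (rfl | ⟨hw, rfl⟩)
    · exact Or.inl rfl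
    · exact Or.inr ⟨hw, rfl⟩
    · exact Or.inr ⟨hv, rfl⟩
    · exact Or.inr ⟨hw, by simp⟩
  le_of_rel := by
    rintro u v (rfl | ⟨-, rfl⟩)
    exacts [le_rfl, inf_le_right]
  smul_rel g u v h := by rwa [triv, triv]
  inf_rel := by
    rintro u v w (rfl | ⟨hv, rfl⟩) hw
    · exact Or.inl (inf_eq_right.2 hw)
    · exact Or.inr ⟨hw.trans_lt hv, by rw [inf_assoc, inf_eq_right.2 hw]⟩

/-- The relations `u → v` having the right lifting property with respect to `a ≤ b`. -/
def lifting (triv : ∀ (g : G) (z : L), g • z = z) (a b : L) : TransferSystem G L where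
  rel u v := u ≤ v ∧ (a ≤ u → b ≤ v → b ≤ u)
  rel_refl _ := ⟨le_rfl, fun _ h => h⟩
  rel_trans := fun h h' =>
    ⟨h.1.trans h'.1, fun ha hb => h.2 ha (h'.2 (ha.trans h.1) hb)⟩
  le_of_rel h := h.1
  smul_rel g u v h := by rwa [triv, triv]
  inf_rel := fun h hw => ⟨inf_le_right, fun ha hb =>
    le_inf (h.2 (ha.trans inf_le_left) (hb.trans hw)) hb⟩

variable (triv : ∀ (g : G) (z : L), g • z = z)

theorem principal_rel {x y : L} (h : x ≤ y) : (principal triv x y).rel x y :=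
  Or.inr ⟨le_rfl, (inf_eq_left.2 h).symm⟩

theorem principal_le_iff {x y : L} (h : x ≤ y) {T : TransferSystem G L} :
    principal triv x y ≤ T ↔ T.rel x y := by
  refine ⟨fun hT => hT (principal_rel triv h), fun hT u v => ?_⟩
  rintro (rfl | ⟨hv, rfl⟩)
  exacts [T.rel_refl _, T.inf_rel hT hv]

theorem principal_injOn :
    Set.InjOn (fun q : L × L => principal triv q.1 q.2) {q | q.1 < q.2} := by
  rintro ⟨x, y⟩ hxy ⟨x', y'⟩ hxy' h
  simp only [Set.mem_ofPred_eq] at hxy hxy' h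
  have h1 : (principal triv x' y').rel x y := h ▸ principal_rel triv hxy.le
  have h2 : (principal triv x y).rel x' y' := h ▸ principal_rel triv hxy'.le
  obtain ⟨hy, hx⟩ := h1.resolve_left hxy.ne
  obtain ⟨hy', hx'⟩ := h2.resolve_left hxy'.ne
  obtain rfl := le_antisymm hy hy'
  rw [inf_eq_left.2 hxy'.le] at hx
  rw [hx]

/-- Every `T` is the join of the principal systems of its strict relations. Conversely, a system
strictly below `principal x y` cannot contain `x → y`, so all of these lie below `principalLower x
y`, and so does their join. -/
theorem joinIrreducibles_eq :
    joinIrreducibles (TransferSystem G L) =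
      (fun q : L × L => principal triv q.1 q.2) '' {q | q.1 < q.2} := by
  ext T
  constructor
  · intro hT
    have hX : T = sSup ((fun q : L × L => principal triv q.1 q.2) ''
        {q | q.1 < q.2 ∧ T.rel q.1 q.2}) := by
      apply le_antisymm
      · intro u v huv
        rcases (T.le_of_rel huv).eq_or_lt with rfl | hlt
        · exact rel_refl _ _
        · exact (principal_le_iff triv hlt.le).1
            (le_sSup (Set.mem_image_of_mem (fun q : L × L => principal triv q.1 q.2)
              (show ((u, v) : L × L) ∈ {q | q.1 < q.2 ∧ T.rel q.1 q.2} from ⟨hlt, huv⟩)))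
      · apply sSup_le
        rintro _ ⟨q, ⟨hq, hT⟩, rfl⟩
        exact (principal_le_iff triv hq.le).2 hT
    exact Set.image_mono (fun q hq => hq.1) (hT _ hX)
  · rintro ⟨⟨x, y⟩, hxy : x < y, rfl⟩ X hX
    by_contra hmem
    simp only at hX hmem
    have hle : sSup X ≤ principalLower triv x y := by
      refine sSup_le fun T hT u v huv => ?_
      have hTle : T ≤ principal triv x y := hX ▸ le_sSup hT
      refine (hTle huv).imp_right fun ⟨hv, hu⟩ => ⟨hv.lt_of_ne ?_, hu⟩
      rintro rfl
      rw [inf_eq_left.2 hxy.le] at hu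
      subst hu
      have : T = principal triv u v := le_antisymm hTle ((principal_le_iff triv hxy.le).2 huv)
      exact hmem (this ▸ hT)
    rcases hle (hX ▸ principal_rel triv hxy.le) with h | h
    exacts [hxy.ne h, h.1.false]

theorem not_lifting_rel {a b : L} (h : a < b) : ¬ (lifting triv a b).rel a b :=
  fun hab => h.not_ge (hab.2 le_rfl le_rfl)

/-- The pair is recovered from the system: unless `c ≤ a` and `d ≤ b`, the relation `a → b`
satisfies the condition of `lifting c d` vacuously, while `lifting a b` omits it. -/
theorem lifting_injOn :
    Set.InjOn (fun q : L × L => lifting triv q.1 q.2) {q | q.1 < q.2} := by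
  have key {a b c d : L} (hab : a < b) (h : lifting triv a b = lifting triv c d) :
      c ≤ a ∧ d ≤ b := by
    by_contra hn
    exact not_lifting_rel triv hab (h ▸ ⟨hab.le, fun h1 h2 => (hn ⟨h1, h2⟩).elim⟩)
  rintro ⟨a, b⟩ hab ⟨c, d⟩ hcd h
  have h1 := key hab h
  have h2 := key hcd h.symm
  exact Prod.ext (le_antisymm h2.1 h1.1) (le_antisymm h2.2 h1.2)

/-- Every relation `x ≤ y` outside of `T` is separated from `T` by some `lifting a b`. -/
theorem exists_le_lifting [Finite L] {T : TransferSystem G L} {x y : L} (hxy : x ≤ y)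
    (h : ¬ T.rel x y) :
    ∃ a b, a < b ∧ T ≤ lifting triv a b ∧ ¬ (lifting triv a b).rel x y := by
  -- The separating pair is `(x, z)`, with `z` minimal above `x` among the elements with `z → y` in
  -- `T`.
  obtain ⟨z, ⟨hxz, hzy⟩, hz⟩ := (Set.toFinite {z | x ≤ z ∧ T.rel z y}).exists_minimal
    ⟨y, hxy, T.rel_refl y⟩
  have hlt : x < z := hxz.lt_of_ne (by rintro rfl; exact h hzy)
  refine ⟨x, z, hlt, fun u v huv => ⟨T.le_of_rel huv, fun hu hv => ?_⟩, fun hrel =>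
    hlt.not_ge (hrel.2 le_rfl (T.le_of_rel hzy))⟩
  -- Restricting `u → v` to `z` and composing with `z → y` gives `u ⊓ z → y`, so minimality of `z`
  -- forces `z ≤ u`.
  have := hz (y := u ⊓ z) ⟨le_inf hu hxz, T.rel_trans (T.inf_rel huv hv) hzy⟩ inf_le_right
  exact this.trans inf_le_left

/-- By `exists_le_lifting`, every `T` is the meet of the lifting systems above it. Conversely,
`lifting a b` is maximal among the systems omitting `a → b`; if it is a meet, some member omits `a →
b` and so equals it. -/
theorem meetIrreducibles_eq [Finite L] :
    meetIrreducibles (TransferSystem G L) =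
      (fun q : L × L => lifting triv q.1 q.2) '' {q | q.1 < q.2} := by
  ext T
  constructor
  · intro hT
    have hX : T = sInf ((fun q : L × L => lifting triv q.1 q.2) ''
        {q | q.1 < q.2 ∧ T ≤ lifting triv q.1 q.2}) := by
      apply le_antisymm
      · apply le_sInf
        rintro _ ⟨q, ⟨-, hT⟩, rfl⟩
        exact hT
      · intro x y hxy
        by_contra hn
        obtain ⟨a, b, hab, hle, hrel⟩ := exists_le_lifting triv (le_of_rel _ hxy) hn
        exact hrel (hxy.2 _ ⟨(a, b), ⟨hab, hle⟩, rfl⟩)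
    exact Set.image_mono (fun q hq => hq.1) (hT _ hX)
  · rintro ⟨⟨a, b⟩, hab : a < b, rfl⟩ X hX
    simp only at hX ⊢
    have hn := not_lifting_rel triv hab
    obtain ⟨T, hT, hTab⟩ : ∃ T ∈ X, ¬ T.rel a b := by
      by_contra! hall
      rw [hX] at hn
      exact hn ⟨hab.le, hall⟩
    have hle : lifting triv a b ≤ T := hX ▸ sInf_le hT
    suffices lifting triv a b = T from this ▸ hT
    refine le_antisymm hle fun x y hxy => ⟨T.le_of_rel hxy, fun ha hb => ?_⟩
    by_contra hbx
    -- If `¬ b ≤ x`, then `a → x ⊓ b` is vacuously in `lifting a b`, hence in `T`; composed with the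
    -- restriction `x ⊓ b → b` of `x → y`, it puts `a → b` in `T`.
    refine hTab (T.rel_trans (hle ⟨le_inf ha hab.le, fun _ h => ?_⟩) (T.inf_rel hxy hb))
    exact (hbx (h.trans inf_le_left)).elim

theorem codensity_eq [Finite L] (triv : ∀ (g : G) (z : L), g • z = z) :
    codensity (TransferSystem G L) =
      (Set.ncard {q : (L × L) × L × L | q.1.1 < q.1.2 ∧ q.2.1 < q.2.2 ∧
        q.2.1 ≤ q.1.1 ∧ q.2.2 ≤ q.1.2 ∧ ¬ q.2.2 ≤ q.1.1} : ℚ) /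
      (Set.ncard {q : L × L | q.1 < q.2} : ℚ) ^ 2 := by
  have hnum : {q : TransferSystem G L × TransferSystem G L |
      q.1 ∈ joinIrreducibles (TransferSystem G L) ∧
      q.2 ∈ meetIrreducibles (TransferSystem G L) ∧ ¬ q.1 ≤ q.2} =
      (fun q : (L × L) × L × L => (principal triv q.1.1 q.1.2, lifting triv q.2.1 q.2.2)) ''
      {q | q.1.1 < q.1.2 ∧ q.2.1 < q.2.2 ∧ q.2.1 ≤ q.1.1 ∧ q.2.2 ≤ q.1.2 ∧
        ¬ q.2.2 ≤ q.1.1} := by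
    have key {x y a b : L} (hxy : x < y) : ¬ principal triv x y ≤ lifting triv a b ↔
        a ≤ x ∧ b ≤ y ∧ ¬ b ≤ x := by
      rw [principal_le_iff triv hxy.le]
      change ¬ (x ≤ y ∧ (a ≤ x → b ≤ y → b ≤ x)) ↔ _
      simp [hxy.le]
    ext ⟨S, T⟩
    simp only [joinIrreducibles_eq triv, meetIrreducibles_eq triv, Set.mem_ofPred_eq,
      Set.mem_image, Prod.exists, Prod.mk.injEq]
    constructor
    · rintro ⟨⟨x, y, hxy, rfl⟩, ⟨a, b, hab, rfl⟩, h⟩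
      exact ⟨x, y, a, b, ⟨hxy, hab, (key hxy).1 h⟩, rfl, rfl⟩
    · rintro ⟨x, y, a, b, ⟨hxy, hab, h⟩, rfl, rfl⟩
      exact ⟨⟨x, y, hxy, rfl⟩, ⟨a, b, hab, rfl⟩, (key hxy).2 h⟩
  rw [codensity, hnum, joinIrreducibles_eq triv, meetIrreducibles_eq triv,
    (principal_injOn triv).ncard_image, (lifting_injOn triv).ncard_image, Set.InjOn.ncard_image,
    sq]
  rintro ⟨p, q⟩ ⟨hp, hq, -⟩ ⟨p', q'⟩ ⟨hp', hq', -⟩ h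
  simp only [Prod.mk.injEq] at h
  exact Prod.ext (principal_injOn triv hp hp' h.1) (lifting_injOn triv hq hq' h.2)

end TransferSystem

end HomotopicalCombinatorics

/-! ### Counting subspaces by Gaussian binomials. -/

namespace HomotopicalCombinatorics

open Module

section Subspaces

variable {K V : Type*} [Field K] [AddCommGroup V] [Module K V]

/-- A linearly independent `k`-tuple is a basis of a unique `k`-dimensional subspace. -/
theorem bijective_linearIndependent_subtype [FiniteDimensional K V] (k : ℕ) :
    Function.Bijective (fun s : (Σ W : {W : Submodule K V // finrank K W = k},
        {t : Fin k → W.1 // LinearIndependent K t}) =>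
      (⟨fun i => (s.2.1 i : V), s.2.2.map' s.1.1.subtype (Submodule.ker_subtype _)⟩ :
        {t : Fin k → V // LinearIndependent K t})) := by
  have key (W : Submodule K V) (hW : finrank K W = k) (t : Fin k → W)
      (ht : LinearIndependent K t) : Submodule.span K (Set.range fun i => (t i : V)) = W := by
    refine Submodule.eq_of_le_of_finrank_eq ?_ ?_
    · rw [Submodule.span_le]
      rintro _ ⟨i, rfl⟩
      exact (t i).2
    · exact (finrank_span_eq_card (ht.map' W.subtype (Submodule.ker_subtype _))).trans
        ((Fintype.card_fin k).trans hW.symm)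
  constructor
  · rintro ⟨⟨W, hW⟩, t, ht⟩ ⟨⟨W', hW'⟩, t', ht'⟩ h
    have h : (fun i => (t i : V)) = fun i => (t' i : V) := congrArg Subtype.val h
    obtain rfl : W = W' := by rw [← key W hW t ht, ← key W' hW' t' ht', h]
    obtain rfl : t = t' := funext fun i => Subtype.ext (congrFun h i)
    rfl
  · rintro ⟨t, ht⟩
    refine ⟨⟨⟨Submodule.span K (Set.range t), ?_⟩,
      fun i => ⟨t i, Submodule.subset_span (Set.mem_range_self i)⟩, ?_⟩, rfl⟩
    · rw [finrank_span_eq_card ht, Fintype.card_fin]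
    · exact LinearIndependent.of_comp (Submodule.subtype _) ht

/-- Isolates the factor depending only on `k`, which cancels between the counts of independent
`k`-tuples in the whole space and in a `k`-dimensional subspace. -/
theorem prod_pow_sub_pow (q : ℚ) {n k : ℕ} (hk : k ≤ n) :
    ∏ i ∈ Finset.range k, (q ^ n - q ^ i) =
      (∏ i ∈ Finset.range k, q ^ i) * ∏ i ∈ Finset.range k, (q ^ (n - i) - 1) := by
  rw [← Finset.prod_mul_distrib]
  refine Finset.prod_congr rfl fun i hi => ?_
  rw [mul_sub, ← pow_add, Nat.add_sub_cancel' ((Finset.mem_range.1 hi).le.trans hk), mul_one]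

theorem finrank_comap_mkQ [FiniteDimensional K V] (U : Submodule K V) (W : Submodule K (V ⧸ U)) :
    finrank K (W.comap U.mkQ) = finrank K W + finrank K U := by
  have h1 := (W.comap U.mkQ).finrank_quotient_add_finrank
  have h2 := W.finrank_quotient_add_finrank
  have h3 := U.finrank_quotient_add_finrank
  have hle : U ≤ W.comap U.mkQ := Submodule.le_comap_mkQ U W
  have h4 := (Submodule.quotientQuotientEquivQuotient U _ hle).finrank_eq
  rw [Submodule.map_comap_eq_of_surjective U.mkQ_surjective] at h4
  omega

variable [Fintype K] [Finite V]

theorem natCast_card_linearIndependent {k : ℕ} (hk : k ≤ finrank K V) :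
    (Nat.card {t : Fin k → V // LinearIndependent K t} : ℚ) =
      ∏ i ∈ Finset.range k, ((Fintype.card K : ℚ) ^ finrank K V - (Fintype.card K : ℚ) ^ i) := by
  rw [card_linearIndependent hk, Nat.cast_prod, ← Fin.prod_univ_eq_prod_range
    (fun i => (Fintype.card K : ℚ) ^ finrank K V - (Fintype.card K : ℚ) ^ i)]
  refine Finset.prod_congr rfl fun i _ => ?_
  rw [Nat.cast_sub (Nat.pow_le_pow_right Fintype.card_pos (i.2.le.trans hk))]
  push_cast
  rfl

/-- The number of `k`-dimensional subspaces is a Gaussian binomial coefficient. -/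
theorem card_submodule_finrank_eq {k : ℕ} (hk : k ≤ finrank K V) :
    (Nat.card {W : Submodule K V // finrank K W = k} : ℚ) =
      gaussBinom (Fintype.card K) (finrank K V) k := by
  have hq : (1 : ℚ) < Fintype.card K := by exact_mod_cast Fintype.one_lt_card (α := K)
  have := Fintype.ofFinite {W : Submodule K V // finrank K W = k}
  have h := Nat.card_eq_of_bijective _ (bijective_linearIndependent_subtype (K := K) (V := V) k)
  rw [Nat.card_sigma] at h
  have h' := congrArg (Nat.cast : ℕ → ℚ) h
  rw [Nat.cast_sum, natCast_card_linearIndependent hk, Finset.sum_congr rfl fun W _ => by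
    rw [natCast_card_linearIndependent W.2.ge, W.2], Finset.sum_const, nsmul_eq_mul,
    prod_pow_sub_pow _ hk, prod_pow_sub_pow _ le_rfl, Finset.card_univ,
    ← Nat.card_eq_fintype_card] at h'
  -- Reversing the product turns the factors into the denominators of `gaussBinom`.
  have hrefl : ∏ i ∈ Finset.range k, ((Fintype.card K : ℚ) ^ (k - i) - 1) =
      ∏ i ∈ Finset.range k, ((Fintype.card K : ℚ) ^ (i + 1) - 1) := by
    rw [← Finset.prod_range_reflect]
    refine Finset.prod_congr rfl fun i hi => ?_
    have := Finset.mem_range.1 hi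
    congr 2
    omega
  rw [hrefl, mul_left_comm] at h'
  rw [gaussBinom, Finset.prod_div_distrib, eq_div_iff]
  · exact mul_left_cancel₀ (Finset.prod_ne_zero_iff.2 fun i _ => (pow_pos (by linarith) i).ne') h'
  · exact Finset.prod_ne_zero_iff.2 fun i _ =>
      (sub_pos.2 (one_lt_pow₀ hq (Nat.succ_ne_zero i))).ne'

theorem sum_submodule [Fintype (Submodule K V)] (f : ℕ → ℚ) :
    ∑ W : Submodule K V, f (finrank K W) =
      ∑ k ∈ Finset.range (finrank K V + 1),
        gaussBinom (Fintype.card K) (finrank K V) k * f k := by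
  classical
  rw [← Finset.sum_fiberwise_of_maps_to (t := Finset.range (finrank K V + 1))
    (g := fun W : Submodule K V => finrank K W)
    fun W _ => Finset.mem_range.2 (Nat.lt_succ_of_le W.finrank_le)]
  refine Finset.sum_congr rfl fun k hk => ?_
  rw [← card_submodule_finrank_eq (Nat.le_of_lt_succ (Finset.mem_range.1 hk)),
    Finset.sum_congr rfl fun W hW => by rw [(Finset.mem_filter.1 hW).2], Finset.sum_const,
    nsmul_eq_mul, Nat.card_eq_fintype_card, Fintype.card_subtype]

/-- Subspaces containing `U` correspond to subspaces of `V ⧸ U`, with the dimension lowered by that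
of `U`. -/
theorem sum_Ici_submodule (U : Submodule K V) [Fintype (Set.Ici U)] (f : ℕ → ℚ) :
    ∑ W : Set.Ici U, f (finrank K W.1 - finrank K U) =
      ∑ k ∈ Finset.range (finrank K V - finrank K U + 1),
        gaussBinom (Fintype.card K) (finrank K V - finrank K U) k * f k := by
  have : Finite (V ⧸ U) := Finite.of_surjective _ U.mkQ_surjective
  have := Fintype.ofFinite (Submodule K (V ⧸ U))
  have h3 := U.finrank_quotient_add_finrank
  rw [← Nat.eq_sub_of_add_eq h3, ← sum_submodule,
    ← (Submodule.comapMkQRelIso U).toEquiv.sum_comp]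
  refine Finset.sum_congr rfl fun W _ => ?_
  change f (finrank K (W.comap U.mkQ) - finrank K U) = _
  rw [finrank_comap_mkQ, Nat.add_sub_cancel]

theorem ncard_Ici_submodule (U : Submodule K V) :
    ((Set.Ici U).ncard : ℚ) = gaussSum (Fintype.card K) (finrank K V - finrank K U) := by
  have := Fintype.ofFinite (Set.Ici U)
  have h := sum_Ici_submodule U (fun _ => 1)
  rw [← Nat.card_coe_set_eq, Nat.card_eq_fintype_card]
  simpa [gaussSum] using h

/-- The interval is the set of subspaces of `W` containing `U`, so the count above a subspace
applies with `W` as ambient space. -/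
theorem ncard_Icc_submodule {U W : Submodule K V} (h : U ≤ W) :
    ((Set.Icc U W).ncard : ℚ) = gaussSum (Fintype.card K) (finrank K W - finrank K U) := by
  have e : Set.Icc U W = (fun X : Submodule K W => X.map W.subtype) ''
      Set.Ici (U.comap W.subtype) := by
    ext X
    constructor
    · rintro ⟨h1, h2⟩
      exact ⟨X.comap W.subtype, Submodule.comap_mono h1, by simpa using h2⟩
    · rintro ⟨Y, hY, rfl⟩
      refine ⟨?_, Submodule.map_subtype_le W Y⟩
      have := Submodule.map_mono (f := W.subtype) hY
      rwa [Submodule.map_comap_subtype, inf_eq_right.2 h] at this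
  rw [e, Set.ncard_image_of_injective _
    (Submodule.map_injective_of_injective W.injective_subtype), ncard_Ici_submodule,
    (Submodule.comapSubtypeEquivOfLe h).finrank_eq]

end Subspaces

end HomotopicalCombinatorics

/-! ### Counting strict pairs and quadruples of subspaces. -/

namespace HomotopicalCombinatorics

open Module

theorem gaussSum_zero (q : ℕ) : gaussSum q 0 = 1 := by
  simp [gaussSum, gaussBinom]

section Counting

variable {K V : Type*} [Field K] [Fintype K] [AddCommGroup V] [Module K V] [Finite V]

/-- Sum over the smaller subspace, whose own contribution to the upper set is the subtracted `1`.
The sum stops before the full dimension because that term is `a_0 - 1 = 0`. -/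
theorem ncard_lt_submodule :
    ({q : Submodule K V × Submodule K V | q.1 < q.2}.ncard : ℚ) =
      ∑ i ∈ Finset.range (finrank K V), gaussBinom (Fintype.card K) (finrank K V) i *
        (gaussSum (Fintype.card K) (finrank K V - i) - 1) := by
  have := Fintype.ofFinite (Submodule K V)
  let e : {q : Submodule K V × Submodule K V | q.1 < q.2} ≃ Σ U : Submodule K V, Set.Ioi U :=
    { toFun := fun q => ⟨q.1.1, q.1.2, q.2⟩
      invFun := fun s => ⟨(s.1, s.2.1), s.2.2⟩
      left_inv := fun _ => rfl
      right_inv := fun _ => rfl }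
  have hcard (U : Submodule K V) : (Nat.card (Set.Ioi U) : ℚ) =
      gaussSum (Fintype.card K) (finrank K V - finrank K U) - 1 := by
    rw [← ncard_Ici_submodule, Nat.card_coe_set_eq, ← Set.Ici_sdiff_left,
      Set.ncard_sdiff_singleton_of_mem Set.self_mem_Ici, Nat.cast_sub, Nat.cast_one]
    exact Nat.succ_le_of_lt ((Set.ncard_pos (Set.toFinite _)).2 Set.nonempty_Ici)
  rw [← Nat.card_coe_set_eq, Nat.card_congr e, Nat.card_sigma, Nat.cast_sum,
    Finset.sum_congr rfl fun U _ => hcard U,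
    sum_submodule (fun i => gaussSum (Fintype.card K) (finrank K V - i) - 1),
    Finset.sum_range_succ, Nat.sub_self, gaussSum_zero]
  simp

theorem card_Icc_not_le_submodule {a b y : Submodule K V} (hab : a ≤ b) (hby : b ≤ y) :
    (Nat.card {x : Submodule K V // a ≤ x ∧ x ≤ y ∧ ¬ b ≤ x} : ℚ) =
      gaussSum (Fintype.card K) (finrank K y - finrank K a) -
        gaussSum (Fintype.card K) (finrank K y - finrank K b) := by
  rw [← ncard_Icc_submodule (hab.trans hby), ← ncard_Icc_submodule hby]
  have hsub : Set.Icc b y ⊆ Set.Icc a y := Set.Icc_subset_Icc_left hab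
  rw [← Nat.cast_sub (Set.ncard_le_ncard hsub (Set.toFinite _)), ← Set.ncard_sdiff hsub]
  congr 1
  rw [← Nat.card_coe_set_eq]
  refine Nat.card_congr (Equiv.subtypeEquivRight fun x => ?_)
  simp only [Set.mem_sdiff, Set.mem_Icc]
  tauto

/-- The quadruple is chosen in the order `a ≤ b ≤ y`, then `x`, so that each choice contributes a
number depending only on relative dimensions. -/
theorem ncard_not_lifting_submodule :
    ({q : (Submodule K V × Submodule K V) × Submodule K V × Submodule K V |
        q.1.1 < q.1.2 ∧ q.2.1 < q.2.2 ∧ q.2.1 ≤ q.1.1 ∧ q.2.2 ≤ q.1.2 ∧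
          ¬ q.2.2 ≤ q.1.1}.ncard : ℚ) =
      ∑ i ∈ Finset.range (finrank K V), ∑ j ∈ Finset.Icc 1 (finrank K V - i),
        ∑ k ∈ Finset.range (finrank K V - i - j + 1),
          gaussBinom (Fintype.card K) (finrank K V) i *
            gaussBinom (Fintype.card K) (finrank K V - i) j *
            gaussBinom (Fintype.card K) (finrank K V - i - j) k *
            (gaussSum (Fintype.card K) (j + k) - gaussSum (Fintype.card K) k) := by
  have := Fintype.ofFinite (Submodule K V)
  have (U : Submodule K V) : Fintype (Set.Ici U) := Fintype.ofFinite _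
  set n := finrank K V
  set q := Fintype.card K
  let e : {q : (Submodule K V × Submodule K V) × Submodule K V × Submodule K V |
        q.1.1 < q.1.2 ∧ q.2.1 < q.2.2 ∧ q.2.1 ≤ q.1.1 ∧ q.2.2 ≤ q.1.2 ∧ ¬ q.2.2 ≤ q.1.1} ≃
      Σ (a : Submodule K V) (b : Set.Ici a) (y : Set.Ici b.1),
        {x : Submodule K V // a ≤ x ∧ x ≤ y.1 ∧ ¬ b.1 ≤ x} :=
    { toFun := fun s => ⟨s.1.2.1, ⟨s.1.2.2, s.2.2.1.le⟩, ⟨s.1.1.2, s.2.2.2.2.1⟩,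
        s.1.1.1, s.2.2.2.1, s.2.1.le, s.2.2.2.2.2⟩
      invFun := fun s => ⟨((s.2.2.2.1, s.2.2.1.1), (s.1, s.2.1.1)),
        -- Both strict inequalities follow from `¬ b ≤ x`: `x = y` would give `b ≤ x` from `b ≤ y`,
        -- and `a = b` would give it from `a ≤ x`. Hence the choices on the sigma side may use weak
        -- inequalities.
        lt_of_le_of_ne s.2.2.2.2.2.1 fun h => s.2.2.2.2.2.2 (s.2.2.1.2.trans (Eq.ge h)),
        lt_of_le_of_ne s.2.1.2 fun h => s.2.2.2.2.2.2 ((Eq.ge h).trans s.2.2.2.2.1),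
        s.2.2.2.2.1, s.2.2.1.2, s.2.2.2.2.2.2⟩
      left_inv := fun _ => rfl
      right_inv := fun _ => rfl }
  have hy (a : Submodule K V) (b : Set.Ici a) :
      ∑ y : Set.Ici b.1, (gaussSum q (finrank K y.1 - finrank K a) -
        gaussSum q (finrank K y.1 - finrank K b.1)) =
      ∑ k ∈ Finset.range (n - finrank K a - (finrank K b.1 - finrank K a) + 1),
        gaussBinom q (n - finrank K a - (finrank K b.1 - finrank K a)) k *
          (gaussSum q (finrank K b.1 - finrank K a + k) - gaussSum q k) := by
    have hab : finrank K a ≤ finrank K b.1 := Submodule.finrank_mono b.2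
    have h := sum_Ici_submodule b.1 fun k =>
      gaussSum q (finrank K b.1 - finrank K a + k) - gaussSum q k
    rw [show n - finrank K a - (finrank K b.1 - finrank K a) = n - finrank K b.1 by omega, ← h]
    refine Finset.sum_congr rfl fun y _ => ?_
    have hby : finrank K b.1 ≤ finrank K y.1 := Submodule.finrank_mono y.2
    rw [show finrank K b.1 - finrank K a + (finrank K y.1 - finrank K b.1) =
      finrank K y.1 - finrank K a by omega]
  have hcard : (Nat.card (Σ (a : Submodule K V) (b : Set.Ici a) (y : Set.Ici b.1),
        {x : Submodule K V // a ≤ x ∧ x ≤ y.1 ∧ ¬ b.1 ≤ x}) : ℚ) =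
      ∑ a : Submodule K V, ∑ b : Set.Ici a, ∑ y : Set.Ici b.1,
        (gaussSum q (finrank K y.1 - finrank K a) -
          gaussSum q (finrank K y.1 - finrank K b.1)) := by
    simp only [Nat.card_sigma, Nat.cast_sum]
    exact Finset.sum_congr rfl fun a _ => Finset.sum_congr rfl fun b _ =>
      Finset.sum_congr rfl fun y _ => card_Icc_not_le_submodule b.2 y.2
  rw [← Nat.card_coe_set_eq, Nat.card_congr e, hcard]
  simp only [hy]
  rw [Finset.sum_congr rfl fun a _ => sum_Ici_submodule a fun j =>
      ∑ k ∈ Finset.range (n - finrank K a - j + 1), gaussBinom q (n - finrank K a - j) k *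
        (gaussSum q (j + k) - gaussSum q k),
    sum_submodule fun i => ∑ j ∈ Finset.range (n - i + 1), gaussBinom q (n - i) j *
      ∑ k ∈ Finset.range (n - i - j + 1), gaussBinom q (n - i - j) k *
        (gaussSum q (j + k) - gaussSum q k), Finset.sum_range_succ]
  -- For `i = n` only `j = 0` remains, and there the difference of Gaussian sums is zero.
  have hlast : gaussBinom q n n * ∑ j ∈ Finset.range (n - n + 1), gaussBinom q (n - n) j *
      ∑ k ∈ Finset.range (n - n - j + 1), gaussBinom q (n - n - j) k *
        (gaussSum q (j + k) - gaussSum q k) = 0 := by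
    simp
  rw [hlast, add_zero]
  refine Finset.sum_congr rfl fun i _ => ?_
  -- Splits off `j = 0`, that is `a = b`, whose summands `a_k - a_k` vanish; this leaves `j`
  -- starting at `1`.
  rw [Finset.range_eq_Ico, Finset.sum_eq_sum_Ico_succ_bot (Nat.succ_pos _)]
  simp only [zero_add, sub_self, mul_zero, Finset.sum_const_zero]
  rw [Finset.mul_sum]
  refine Finset.sum_congr rfl fun j _ => ?_
  rw [← mul_assoc, Finset.mul_sum]
  exact Finset.sum_congr rfl fun k _ => (mul_assoc _ _ _).symm

/-- Both counts in `codensity_eq` involve only the order of `L`, so they can be computed in any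
isomorphic lattice. -/
theorem codensity_eq_of_orderIso_submodule {G L : Type*} [Group G] [Lattice L] [Finite L]
    [MulAction G L] [CovariantClass G L (· • ·) (· ≤ ·)] (triv : ∀ (g : G) (z : L), g • z = z)
    (e : L ≃o Submodule K V) {q n : ℕ} (hq : Fintype.card K = q) (hn : finrank K V = n) :
    codensity (TransferSystem G L) =
      (∑ i ∈ Finset.range n, ∑ j ∈ Finset.Icc 1 (n - i), ∑ k ∈ Finset.range (n - i - j + 1),
          gaussBinom q n i * gaussBinom q (n - i) j * gaussBinom q (n - i - j) k *
            (gaussSum q (j + k) - gaussSum q k)) /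
        (∑ i ∈ Finset.range n, gaussBinom q n i * (gaussSum q (n - i) - 1)) ^ 2 := by
  subst hq hn
  let e₂ := e.toEquiv.prodCongr e.toEquiv
  have hlt : {q : L × L | q.1 < q.2}.ncard =
      {q : Submodule K V × Submodule K V | q.1 < q.2}.ncard := by
    rw [← Nat.card_coe_set_eq, ← Nat.card_coe_set_eq]
    exact Nat.card_congr (e₂.subtypeEquiv fun q => e.lt_iff_lt.symm)
  have hnot : {q : (L × L) × L × L | q.1.1 < q.1.2 ∧ q.2.1 < q.2.2 ∧
        q.2.1 ≤ q.1.1 ∧ q.2.2 ≤ q.1.2 ∧ ¬ q.2.2 ≤ q.1.1}.ncard =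
      {q : (Submodule K V × Submodule K V) × Submodule K V × Submodule K V |
        q.1.1 < q.1.2 ∧ q.2.1 < q.2.2 ∧ q.2.1 ≤ q.1.1 ∧ q.2.2 ≤ q.1.2 ∧
          ¬ q.2.2 ≤ q.1.1}.ncard := by
    rw [← Nat.card_coe_set_eq, ← Nat.card_coe_set_eq]
    exact Nat.card_congr ((e₂.prodCongr e₂).subtypeEquiv fun q => by simp [e₂])
  rw [TransferSystem.codensity_eq triv, hlt, hnot, ncard_not_lifting_submodule,
    ncard_lt_submodule]

end Counting

/-! ### Elementary abelian groups as vector spaces, and the final formula. -/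

/-- The additive form of `C_p^n` is the `n`-dimensional coordinate space over `ZMod p`. -/
def additiveElemAbEquiv (p n : ℕ) : Additive (ElemAb p n) ≃+ (Fin n → ZMod p) where
  toFun f i := (f.toMul i).toAdd
  invFun f := Additive.ofMul fun i => Multiplicative.ofAdd (f i)
  left_inv _ := rfl
  right_inv _ := rfl
  map_add' _ _ := rfl

/-- Subgroups of `C_p^n` are the same as subspaces of the coordinate space. -/
def subgroupElemAbOrderIso (p n : ℕ) :
    Subgroup (ElemAb p n) ≃o Submodule (ZMod p) (Fin n → ZMod p) :=
  Subgroup.toAddSubgroup.trans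
    ((additiveElemAbEquiv p n).mapAddSubgroup.trans (AddSubgroup.toZModSubmodule p))

end HomotopicalCombinatorics

open HomotopicalCombinatorics in
theorem theorem6p1 (p n : ℕ) [Fact p.Prime] (hn : 0 < n) :
    codensity (TrSub (ElemAb p n)) =
      (∑ i ∈ Finset.range n, ∑ j ∈ Finset.Icc 1 (n - i), ∑ k ∈ Finset.range (n - i - j + 1),
          gaussBinom p n i * gaussBinom p (n - i) j * gaussBinom p (n - i - j) k *
            (gaussSum p (j + k) - gaussSum p k)) /
        (∑ i ∈ Finset.range n, gaussBinom p n i * (gaussSum p (n - i) - 1)) ^ 2 := by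
  -- Every subgroup of a commutative group is normal, so conjugation acts trivially.
  have triv (g : ConjAct (ElemAb p n)) (H : Subgroup (ElemAb p n)) : g • H = H :=
    Subgroup.Normal.conjAct inferInstance g
  exact codensity_eq_of_orderIso_submodule triv
    (subgroupElemAbOrderIso p n) (ZMod.card p) (Module.finrank_fin_fun (ZMod p))
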